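/- For $p\in\mathbb N_0$ let $w_0(x)=1$ and $w_p(x)=\frac1{1+x^p}$ $(p\ge 1)$, and let $C_p[0,\infty)$ be the set of all $f:[0,\infty)\to\mathbb R$ such that $w_pf$ is bounded and uniformly continuous on $[0,\infty)$, with $\|f\|_p=\sup_{x\ge 0}w_p(x)|f(x)|$. Put $\Delta_h^2f(x)=f(x+2h)-2f(x+h)+f(x)$ and, for $f\in C_p[0,\infty)$, $$\omega_p^2(f,\delta)=\sup_{0<h\le\delta}\|\Delta_h^2f\|_p\quad(\delta>0),\qquad \omega_p^1(f,\delta)=\sup\{w_p(x)|f(t)-f(x)|:\ t,x\ge0,\ |t-x|\le\delta\}\quad(\delta\ge0).$$ For $\alpha\in(0,2]$ let $\mathrm{Lip}_p^2\alpha$ be the set of all $f\in C_p[0,\infty)$ with $\omega_p^2(f,\delta)=O(\delta^\alpha)$ as $\delta\to0^+$. For integers $1\le k\le n$ and $x>0$ let $$M_{n,k}(f;x)=\frac{(2n-k+1)!\,x^{n+1}}{n!\,(n-k)!}\int_0^\infty\frac{t^{n-k}}{(x+t)^{2n-k+2}}f(t)\,dt .$$ **Theorem.** Let $p\in\mathbb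 N_0$ and let $k\ge1$ be an integer. (i) There is a constant $N_{p,k}>0$, depending only on $p$ and $k$, such that for all integers $n\ge\max\{k,p+2\}$, all $f\in C_p[0,\infty)$ and all $x>0$, $$w_p(x)\,|M_{n,k}(f;x)-f(x)|\le N_{p,k}\,\omega_p^2\!\left(f,\frac{x}{\sqrt n}\right)+\omega_p^1\!\left(f,\frac{|1-k|}{n}x\right).$$ (ii) If $\alpha\in(0,2]$ and $f\in \mathrm{Lip}_p^2\alpha$, then there is a constant $C>0$, depending only on $p$, $k$, $\alpha$ and $f$, such that for all integers $n\ge\max\{k,p+2\}$ and all $x>0$, $$w_p(x)\,|M_{n,k}(f;x)-f(x)|\le C\left(\frac{x^2}{n}\right)^{\alpha/2}+\omega_p^1\!\left(f,\frac{|1-k|}{n}x\right).$$ -/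

import Mathlib

open scoped Topology

namespace GammaType

noncomputable section

/-- The polynomial weight `w_p` : `w_0 = 1` and `w_p(x) = 1 / (1 + x ^ p)` for `p ≥ 1`. -/
def weight (p : ℕ) (x : ℝ) : ℝ :=
  if p = 0 then 1 else 1 / (1 + x ^ p)

/-- The space `C_p[0,∞)`. Functions on `[0,∞)` are represented by functions on `ℝ` of which only
the values on `[0,∞)` are ever used. -/
def Cp (p : ℕ) : Set (ℝ → ℝ) :=
  {f | (∃ C : ℝ, ∀ x, 0 ≤ x → |weight p x * f x| ≤ C) ∧
    UniformContinuousOn (fun x => weight p x * f x) (Set.Ici 0)}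

/-- The weighted norm `‖f‖_p = sup_{x ≥ 0} w_p(x) |f(x)|`. -/
def wnorm (p : ℕ) (f : ℝ → ℝ) : ℝ :=
  sSup ((fun x => weight p x * |f x|) '' Set.Ici 0)

/-- The second difference `Δ_h² f(x) = f(x + 2h) - 2 f(x + h) + f(x)`. -/
def secondDiff (h : ℝ) (f : ℝ → ℝ) (x : ℝ) : ℝ :=
  f (x + 2 * h) - 2 * f (x + h) + f x

/-- The weighted second-order modulus `ω_p²(f; δ) = sup_{0 < h ≤ δ} ‖Δ_h² f‖_p`. -/
def omega2 (p : ℕ) (f : ℝ → ℝ) (δ : ℝ) : ℝ :=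
  sSup ((fun h => wnorm p (secondDiff h f)) '' Set.Ioc 0 δ)

/-- The weighted first-order modulus
`ω_p¹(f; δ) = sup {w_p(x) |f(t) - f(x)| : |t - x| ≤ δ, t ≥ 0, x ≥ 0}`. -/
def omega1 (p : ℕ) (f : ℝ → ℝ) (δ : ℝ) : ℝ :=
  sSup {y | ∃ t x : ℝ, 0 ≤ t ∧ 0 ≤ x ∧ |t - x| ≤ δ ∧ y = weight p x * |f t - f x|}

/-- The class `Lip_p² α` of those `f ∈ C_p` with `ω_p²(f; δ) = O(δ ^ α)` as `δ → 0⁺`. -/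
def Lip2 (p : ℕ) (α : ℝ) : Set (ℝ → ℝ) :=
  {f | f ∈ Cp p ∧ (fun δ : ℝ => omega2 p f δ) =O[𝓝[>] (0 : ℝ)] (fun δ : ℝ => δ ^ α)}

/-- The kernel `K_{n,k}(x,t)`, used for `k ≤ n` and `x, t > 0`. -/
def kernel (n k : ℕ) (x t : ℝ) : ℝ :=
  (((2 * n - k + 1).factorial : ℝ) * x ^ (n + 1)) / ((n.factorial : ℝ) * ((n - k).factorial : ℝ)) *
    (t ^ (n - k) / (x + t) ^ (2 * n - k + 2))

/-- The general Gamma type operator `M_{n,k}(f; x) = ∫_0^∞ K_{n,k}(x,t) f(t) dt`. -/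
def M (n k : ℕ) (f : ℝ → ℝ) (x : ℝ) : ℝ :=
  ∫ t in Set.Ioi (0 : ℝ), kernel n k x t * f t

end

end GammaType

open MeasureTheory Set Filter

namespace GammaType

/-! The kernel is a probability density whose moments are Beta integrals: its mean is `y = (n - k +
1) / n * x`, and `(t - x) ^ 2 * t ^ p` has mean of order `x ^ (p + 2) / n` (`centralMoment_le`).
Since `t - y` has mean zero, any multiple of it may be subtracted from `f` when estimating `M f(x) -
f(y)`. A Steklov mean `g` of step `h` satisfies `|f - g| ≲ ω²(h)` and `|g''| ≲ ω²(h) / h²` up to the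
weight, so Taylor expansion of `g` at `y` leaves `ω²(h) (1 + (t - y)² / h²)`. With `h = x / √n` the
second moment cancels `h²` (`abs_M_sub_le`). The shift `|y - x| = |1 - k| x / n` costs exactly the
`ω¹` term. Part (ii) follows from (i) for small `x / √n`, and from uniform boundedness of the error
otherwise. -/

/-! ### Beta integrals on the half line. -/

lemma tendsto_const_div_add_pow (x c : ℝ) (b : ℕ) :
    Tendsto (fun t : ℝ => c / (x + t) ^ (b + 1)) atTop (𝓝 0) := by
  refine Tendsto.const_div_atTop ?_ c
  exact (tendsto_pow_atTop (by omega)).comp (tendsto_atTop_add_const_left _ x tendsto_id)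

lemma hasDerivAt_neg_inv_add_pow {x t : ℝ} (h : x + t ≠ 0) (b : ℕ) :
    HasDerivAt (fun t : ℝ => (-1 / (b + 1)) / (x + t) ^ (b + 1)) (1 / (x + t) ^ (b + 2)) t := by
  have h1 : HasDerivAt (fun t : ℝ => (x + t) ^ (b + 1)) (((b + 1 : ℕ) : ℝ) * (x + t) ^ b * 1) t := by
    simpa using ((hasDerivAt_id t).const_add x).fun_pow (b + 1)
  have h2 := (hasDerivAt_const t (-1 / ((b : ℝ) + 1))).div h1 (pow_ne_zero _ h)
  refine h2.congr_deriv ?_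
  have : (b : ℝ) + 1 ≠ 0 := by positivity
  field_simp
  push_cast
  ring

lemma integrableOn_inv_add_pow {x : ℝ} (hx : 0 < x) (b : ℕ) :
    IntegrableOn (fun t : ℝ => 1 / (x + t) ^ (b + 2)) (Ioi 0) := by
  refine integrableOn_Ioi_deriv_of_nonneg' (fun t (ht : 0 ≤ t) =>
    hasDerivAt_neg_inv_add_pow (by positivity) b) (fun t (ht : 0 < t) => by positivity)
    (tendsto_const_div_add_pow x _ b)

lemma integrableOn_pow_div_add_pow {x : ℝ} (hx : 0 < x) (a b : ℕ) :
    IntegrableOn (fun t : ℝ => t ^ a / (x + t) ^ (a + b + 2)) (Ioi 0) := by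
  refine (integrableOn_inv_add_pow hx b).mono' ?_ ?_
  · refine ContinuousOn.aestronglyMeasurable ?_ measurableSet_Ioi
    refine ContinuousOn.div (by fun_prop) (by fun_prop) fun t (ht : 0 < t) => by positivity
  · filter_upwards [self_mem_ae_restrict measurableSet_Ioi] with t (ht : 0 < t)
    rw [Real.norm_of_nonneg (by positivity), add_assoc, pow_add, div_le_div_iff₀ (by positivity)
      (by positivity), one_mul]
    gcongr
    linarith

/-- The Beta integral on the half line with integer exponents. -/
lemma integral_pow_div_add_pow {x : ℝ} (hx : 0 < x) (a b : ℕ) :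
    ∫ t in Ioi (0 : ℝ), t ^ a / (x + t) ^ (a + b + 2) =
      (a.factorial * b.factorial : ℝ) / ((a + b + 1).factorial * x ^ (b + 1)) := by
  induction a with
  | zero =>
    have := integral_Ioi_of_hasDerivAt_of_nonneg' (fun t (ht : t ∈ Ici (0 : ℝ)) =>
      hasDerivAt_neg_inv_add_pow (add_pos_of_pos_of_nonneg hx ht).ne' b)
      (fun t (ht : 0 < t) => by positivity) (tendsto_const_div_add_pow x _ b)
    simp only [pow_zero, zero_add]
    rw [this, Nat.factorial_succ]
    push_cast
    have h1 : (b.factorial : ℝ) ≠ 0 := by positivity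
    field_simp
    simp
  | succ a ih =>
    -- Writing `x = (x + t) - t` in the derivative yields the two integrands of the recursion in
    -- `a`; the boundary terms vanish.
    have hd : ∀ t ∈ Ici (0 : ℝ), HasDerivAt (fun t : ℝ => t ^ (a + 1) / (x + t) ^ (a + b + 2))
        ((a + 1) * (t ^ a / (x + t) ^ (a + b + 2)) -
          (a + b + 2) * (t ^ (a + 1) / (x + t) ^ (a + 1 + b + 2))) t := by
      intro t (ht : 0 ≤ t)
      have h0 : x + t ≠ 0 := by positivity
      have h1 : HasDerivAt (fun t : ℝ => (x + t) ^ (a + b + 2))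
          (((a + b + 2 : ℕ) : ℝ) * (x + t) ^ (a + b + 1) * 1) t := by
        simpa using ((hasDerivAt_id t).const_add x).fun_pow (a + b + 2)
      have h2 := (hasDerivAt_pow (a + 1) t).div h1 (pow_ne_zero _ h0)
      refine h2.congr_deriv ?_
      rw [show a + 1 + b + 2 = (a + b + 2) + 1 by ring]
      simp only [Nat.add_sub_cancel]
      field_simp
      push_cast
      ring
    have hi1 := (integrableOn_pow_div_add_pow hx a b).const_mul ((a : ℝ) + 1)
    have hi2 := (integrableOn_pow_div_add_pow hx (a + 1) b).const_mul ((a : ℝ) + b + 2)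
    have hlim : Tendsto (fun t : ℝ => t ^ (a + 1) / (x + t) ^ (a + b + 2)) atTop (𝓝 0) := by
      refine tendsto_of_tendsto_of_tendsto_of_le_of_le' tendsto_const_nhds
        (tendsto_const_div_add_pow x 1 b) ?_ ?_
      · filter_upwards [eventually_gt_atTop 0] with t ht
        positivity
      · filter_upwards [eventually_gt_atTop 0] with t ht
        rw [show a + b + 2 = (a + 1) + (b + 1) by ring, pow_add _ (a + 1), div_le_div_iff₀
          (by positivity) (by positivity), one_mul]
        gcongr
        linarith
    have := integral_Ioi_of_hasDerivAt_of_tendsto' hd (hi1.sub hi2) hlim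
    rw [integral_sub hi1 hi2, integral_const_mul, integral_const_mul, ih] at this
    have h3 : (∫ t in Ioi (0 : ℝ), t ^ (a + 1) / (x + t) ^ (a + 1 + b + 2)) =
        (a + 1) / (a + b + 2) *
          ((a.factorial * b.factorial : ℝ) / ((a + b + 1).factorial * x ^ (b + 1))) := by
      simp at this
      have : ((a : ℝ) + b + 2) ≠ 0 := by positivity
      rw [div_mul_eq_mul_div, eq_div_iff this]
      linarith
    rw [h3, show a + 1 + b + 1 = (a + b + 1) + 1 by ring, Nat.factorial_succ (a + b + 1),
      Nat.factorial_succ a]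
    push_cast
    have : ((a : ℝ) + b + 2) ≠ 0 := by positivity
    have : ((a : ℝ) + b + 1 + 1) ≠ 0 := by positivity
    field_simp
    ring

/-! ### Moments of the kernel. -/

/-- The coefficient of `x ^ m` in the `m`-th moment of the kernel. -/
noncomputable def momentCoeff (n k m : ℕ) : ℝ :=
  ((n - k + m).factorial * (n - m).factorial : ℝ) / (n.factorial * (n - k).factorial)

lemma momentCoeff_nonneg (n k m : ℕ) : 0 ≤ momentCoeff n k m := by
  unfold momentCoeff; positivity

@[simp] lemma momentCoeff_zero (n k : ℕ) : momentCoeff n k 0 = 1 := by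
  unfold momentCoeff
  have := n.factorial_ne_zero
  have := (n - k).factorial_ne_zero
  simp only [add_zero, Nat.sub_zero]
  field_simp

lemma momentCoeff_succ {n k m : ℕ} (hk : k ≤ n) (hm : m < n) :
    momentCoeff n k (m + 1) = momentCoeff n k m * ((n - k + m + 1) / (n - m)) := by
  obtain ⟨j, rfl⟩ : ∃ j, n = m + 1 + j := ⟨n - (m + 1), by omega⟩
  unfold momentCoeff
  rw [show m + 1 + j - m = j + 1 by omega, show m + 1 + j - (m + 1) = j by omega,
    ← add_assoc, Nat.factorial_succ (_ + m), Nat.factorial_succ j]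
  push_cast [Nat.cast_sub hk]
  have : (j : ℝ) + 1 ≠ 0 := by positivity
  have : ((m : ℝ) + 1 + j - m) ≠ 0 := by ring_nf; positivity
  field_simp
  ring

/-- `u` is integrable against the kernel at `x`, with integral `I`. -/
def HasMean (n k : ℕ) (x : ℝ) (u : ℝ → ℝ) (I : ℝ) : Prop :=
  IntegrableOn (fun t => kernel n k x t * u t) (Ioi 0) ∧ M n k u x = I

namespace HasMean

variable {n k : ℕ} {x : ℝ} {u v : ℝ → ℝ} {I J : ℝ}

lemma add (hu : HasMean n k x u I) (hv : HasMean n k x v J) :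
    HasMean n k x (fun t => u t + v t) (I + J) := by
  refine ⟨(hu.1.add hv.1).congr (Eventually.of_forall fun t => ?_), ?_⟩
  · simp [mul_add]
  · rw [← hu.2, ← hv.2, M, M, M, ← integral_add hu.1 hv.1]
    simp only [mul_add]

lemma const_mul (hu : HasMean n k x u I) (c : ℝ) :
    HasMean n k x (fun t => c * u t) (c * I) := by
  refine ⟨(Integrable.const_mul hu.1 c).congr (Eventually.of_forall fun t => ?_), ?_⟩
  · simp [mul_left_comm]
  · rw [← hu.2, M, M, ← integral_const_mul]
    simp only [mul_left_comm]

lemma congr (hu : HasMean n k x u I) (huv : ∀ t, u t = v t) (hIJ : I = J) :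
    HasMean n k x v J := by
  obtain rfl : u = v := funext huv
  exact hIJ ▸ hu

end HasMean

lemma kernel_nonneg {n k : ℕ} {x t : ℝ} (hx : 0 ≤ x) (ht : 0 ≤ t) : 0 ≤ kernel n k x t := by
  unfold kernel; positivity

lemma HasMean.abs_le {n k : ℕ} {x : ℝ} {u v : ℝ → ℝ} {I J : ℝ} (hx : 0 ≤ x)
    (hu : HasMean n k x u I) (hv : HasMean n k x v J) (h : ∀ t, 0 ≤ t → |u t| ≤ v t) :
    |I| ≤ J := by
  rw [← hu.2, ← hv.2, M, M, ← Real.norm_eq_abs]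
  refine norm_integral_le_of_norm_le hv.1 ?_
  filter_upwards [self_mem_ae_restrict measurableSet_Ioi] with t (ht : 0 < t)
  rw [norm_mul, Real.norm_of_nonneg (kernel_nonneg hx ht.le)]
  exact mul_le_mul_of_nonneg_left (h t ht.le) (kernel_nonneg hx ht.le)

lemma HasMean.of_abs_le {n k : ℕ} {x : ℝ} {u v : ℝ → ℝ} {J : ℝ} (hx : 0 < x)
    (hu : ContinuousOn u (Ioi 0)) (hv : HasMean n k x v J) (h : ∀ t, 0 ≤ t → |u t| ≤ v t) :
    HasMean n k x u (M n k u x) := by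
  refine ⟨hv.1.mono' ?_ ?_, rfl⟩
  · refine ContinuousOn.aestronglyMeasurable ?_ measurableSet_Ioi
    refine ContinuousOn.mul ?_ hu
    unfold kernel
    refine continuousOn_const.mul (ContinuousOn.div (by fun_prop) (by fun_prop) ?_)
    exact fun t (ht : 0 < t) => by positivity
  filter_upwards [self_mem_ae_restrict measurableSet_Ioi] with t (ht : 0 < t)
  rw [norm_mul, Real.norm_of_nonneg (kernel_nonneg hx.le ht.le)]
  exact mul_le_mul_of_nonneg_left (h t ht.le) (kernel_nonneg hx.le ht.le)

lemma hasMean_pow {n k m : ℕ} {x : ℝ} (hx : 0 < x) (hk : k ≤ n) (hm : m ≤ n) :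
    HasMean n k x (fun t => t ^ m) (momentCoeff n k m * x ^ m) := by
  have key : ∀ t, kernel n k x t * t ^ m =
      (((2 * n - k + 1).factorial : ℝ) * x ^ (n + 1)) / (n.factorial * (n - k).factorial) *
        (t ^ (n - k + m) / (x + t) ^ (n - k + m + (n - m) + 2)) := by
    intro t
    rw [kernel, show n - k + m + (n - m) + 2 = 2 * n - k + 2 by omega, pow_add]
    ring
  refine ⟨?_, ?_⟩
  · simp only [key]
    exact Integrable.const_mul (integrableOn_pow_div_add_pow hx _ _) _
  · simp only [M, key]
    rw [integral_const_mul, integral_pow_div_add_pow hx, momentCoeff,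
      show n - k + m + (n - m) + 1 = 2 * n - k + 1 by omega,
      show x ^ (n + 1) = x ^ (n - m + 1) * x ^ m by rw [← pow_add]; congr 1; omega]
    have := (2 * n - k + 1).factorial_ne_zero
    have := n.factorial_ne_zero
    have := (n - k).factorial_ne_zero
    field_simp

lemma hasMean_const {n k : ℕ} {x : ℝ} (hx : 0 < x) (hk : k ≤ n) (c : ℝ) :
    HasMean n k x (fun _ => c) c :=
  ((hasMean_pow hx hk n.zero_le).const_mul c).congr (by simp) (by simp)

lemma hasMean_sub_sq_mul_pow {n k m : ℕ} {x : ℝ} (hx : 0 < x) (hk : k ≤ n) (hm : m + 2 ≤ n) :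
    HasMean n k x (fun t => (t - x) ^ 2 * t ^ m)
      ((momentCoeff n k (m + 2) - 2 * momentCoeff n k (m + 1) + momentCoeff n k m) *
        x ^ (m + 2)) := by
  refine (((hasMean_pow hx hk hm).add ((hasMean_pow hx hk (m := m + 1) (by omega)).const_mul
    (-2 * x))).add ((hasMean_pow hx hk (m := m) (by omega)).const_mul (x ^ 2))).congr ?_ ?_
  · intro t; ring
  · ring

/-- Each ratio of consecutive coefficients is at most `2 * p + 1`, because `k ≥ 1` and `m < p < n`.
-/
lemma momentCoeff_le {n k p : ℕ} (hk1 : 1 ≤ k) (hk : k ≤ n) (hp : p + 1 ≤ n) :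
    ∀ m ≤ p, momentCoeff n k m ≤ (2 * p + 1) ^ m := by
  have hp' : (p : ℝ) + 1 ≤ n := by exact_mod_cast hp
  have hk1' : (1 : ℝ) ≤ k := by exact_mod_cast hk1
  have hk' : (k : ℝ) ≤ n := by exact_mod_cast hk
  intro m hm
  induction m with
  | zero => simp
  | succ m ih =>
    have hm' : (m : ℝ) + 1 ≤ p := by exact_mod_cast hm
    rw [momentCoeff_succ hk (by omega), pow_succ]
    refine mul_le_mul (ih (by omega)) ?_ (div_nonneg ?_ ?_) (by positivity)
    · rw [div_le_iff₀ (by linarith)]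
      nlinarith [Nat.cast_nonneg (α := ℝ) p]
    · linarith [Nat.cast_nonneg (α := ℝ) m]
    · linarith

/-- After factoring out the `p`-th coefficient, the terms quadratic in `n` cancel in the numerator,
leaving a linear one over a quadratic denominator. -/
lemma centralMoment_le {n k p : ℕ} (hk1 : 1 ≤ k) (hk : k ≤ n) (hp : p + 2 ≤ n) :
    momentCoeff n k (p + 2) - 2 * momentCoeff n k (p + 1) + momentCoeff n k p ≤
      (2 * p + 1) ^ p * ((2 * p + k + 4) ^ 2 + 2) * (p + 2) / n := by
  have hp' : (p : ℝ) + 2 ≤ n := by exact_mod_cast hp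
  have hk1' : (1 : ℝ) ≤ k := by exact_mod_cast hk1
  have hk' : (k : ℝ) ≤ n := by exact_mod_cast hk
  have hp0 : (0 : ℝ) ≤ p := p.cast_nonneg
  have hA := momentCoeff_le hk1 hk (p := p) (by omega) p le_rfl
  have hA0 := momentCoeff_nonneg n k p
  rw [momentCoeff_succ hk (m := p + 1) (by omega), momentCoeff_succ hk (m := p) (by omega)]
  push_cast
  set A := momentCoeff n k p
  obtain ⟨b, hb⟩ : ∃ b : ℝ, (n : ℝ) = p + 1 + b := ⟨n - p - 1, by ring⟩
  have hb1 : 1 ≤ b := by linarith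
  set Q : ℝ := (2 * p + k + 4) ^ 2 + 2
  have e : A * (((n : ℝ) - k + p + 1) / (n - p)) * ((n - k + (p + 1) + 1) / (n - (p + 1))) -
      2 * (A * ((n - k + p + 1) / (n - p))) + A =
      A * (2 * (b + 1) + (2 * p - k + 1) * (2 * p - k + 4)) / ((b + 1) * b) := by
    rw [show (n : ℝ) - p = b + 1 by rw [hb]; ring, show (n : ℝ) - (p + 1) = b by rw [hb]; ring, hb]
    have : b + 1 ≠ 0 := by positivity
    field_simp
    ring
  have e2 : 2 * (b + 1) + ((2 : ℝ) * p - k + 1) * (2 * p - k + 4) ≤ Q * (b + 1) := by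
    have : ((2 : ℝ) * p - k + 1) * (2 * p - k + 4) ≤ (2 * p + k + 4) ^ 2 := by nlinarith
    simp only [Q]
    nlinarith [sq_nonneg ((2 : ℝ) * p + k + 4)]
  have hQ : 0 ≤ Q := by positivity
  rw [e]
  calc A * (2 * (b + 1) + (2 * p - k + 1) * (2 * p - k + 4)) / ((b + 1) * b)
      ≤ (2 * p + 1) ^ p * (Q * (b + 1)) / ((b + 1) * b) := by
        gcongr ?_ / _
        exact (mul_le_mul_of_nonneg_left e2 hA0).trans (by gcongr)
    _ = (2 * p + 1) ^ p * Q / b := by field_simp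
    -- `n = p + 1 + b ≤ (p + 2) * b` because `b ≥ 1`.
    _ ≤ _ := by
        have hn : (0 : ℝ) < n := by linarith
        rw [div_le_div_iff₀ (by positivity) (by positivity), mul_assoc _ _ b]
        refine mul_le_mul_of_nonneg_left ?_ (by positivity)
        rw [hb]; nlinarith

/-! ### Taylor expansion and Steklov means. -/

lemma abs_sub_sub_mul_le {g g' g'' : ℝ → ℝ} (hg : ∀ x, HasDerivAt g (g' x) x)
    (hg' : ∀ x, HasDerivAt g' (g'' x) x) {y t B : ℝ} (hB : ∀ u ∈ uIcc y t, |g'' u| ≤ B) :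
    |g t - g y - g' y * (t - y)| ≤ B * (t - y) ^ 2 := by
  have hB0 : 0 ≤ B := (abs_nonneg _).trans (hB y left_mem_uIcc)
  have h1 : ∀ u ∈ uIcc y t, |g' u - g' y| ≤ B * |t - y| := by
    intro u hu
    have := (convex_uIcc y t).norm_image_sub_le_of_norm_hasDerivWithin_le
      (fun x _ => (hg' x).hasDerivWithinAt) hB left_mem_uIcc hu
    exact this.trans (mul_le_mul_of_nonneg_left (abs_sub_left_of_mem_uIcc hu) hB0)
  have h2 := (convex_uIcc y t).norm_image_sub_le_of_norm_hasDerivWithin_le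
    (f := fun u => g u - g' y * u)
    (fun x _ => ((hg x).sub ((hasDerivAt_id x).const_mul (g' y))).hasDerivWithinAt)
    (fun x hx => by simpa using h1 x hx) left_mem_uIcc right_mem_uIcc
  rw [Real.norm_eq_abs, Real.norm_eq_abs, mul_assoc, abs_mul_abs_self, ← sq] at h2
  convert h2 using 2
  ring

lemma hasDerivAt_secondDiff {F F' : ℝ → ℝ} (hF : ∀ x, HasDerivAt F (F' x) x) (h x : ℝ) :
    HasDerivAt (secondDiff h F) (secondDiff h F' x) x :=
  (((hF _).comp_add_const x (2 * h)).sub (((hF _).comp_add_const x h).const_mul 2)).add (hF x)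

/-- The left side is the integral of `secondDiff (s + t) f x` over `(s, t) ∈ [0, a]²`, written with
the antiderivatives `F` and `G`. The mean value inequality, applied in `t` and then in `s`, replaces
the double integral. -/
lemma abs_sub_steklov_le {f F G : ℝ → ℝ} (hG : ∀ x, HasDerivAt G (F x) x)
    (hF : ∀ x, HasDerivAt F (f x) x) {a x C : ℝ} (ha : 0 ≤ a)
    (hC : ∀ h, 0 ≤ h → h ≤ 2 * a → |secondDiff h f x| ≤ C) :
    |a ^ 2 * f x - 2 * secondDiff a G x + secondDiff (2 * a) G x / 4| ≤ C * a ^ 2 := by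
  have hshift : ∀ {P P' : ℝ → ℝ}, (∀ x, HasDerivAt P (P' x) x) → ∀ z t : ℝ,
      HasDerivAt (fun t => P (z + 2 * t)) (P' (z + 2 * t) * 2) t := by
    intro P P' hP z t
    have h2 : HasDerivAt (fun t : ℝ => z + 2 * t) 2 t := by
      simpa using ((hasDerivAt_id t).const_mul (2 : ℝ)).const_add z
    exact (hP _).comp t h2
  have h1 : ∀ s ∈ Icc 0 a, |a * f x - 2 * (F (x + s + a) - F (x + s)) +
      (F (x + 2 * s + 2 * a) - F (x + 2 * s)) / 2| ≤ C * a := by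
    intro s hs
    have := (convex_Icc 0 a).norm_image_sub_le_of_norm_hasDerivWithin_le
      (f := fun t => t * f x - 2 * F (x + s + t) + F (x + 2 * s + 2 * t) / 2) (C := C)
      (fun t _ => ((((hasDerivAt_id t).mul_const (f x)).sub
        (((hF _).comp_const_add (x + s) t).const_mul 2)).add
        ((hshift hF (x + 2 * s) t).div_const 2)).hasDerivWithinAt)
      (fun t ht => ?_) (left_mem_Icc.2 ha) (right_mem_Icc.2 ha)
    · rw [Real.norm_eq_abs, Real.norm_eq_abs, sub_zero, abs_of_nonneg ha] at this
      convert this using 2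
      simp only [mul_zero, add_zero]
      ring
    · convert hC (s + t) (add_nonneg hs.1 ht.1) (by linarith [hs.2, ht.2]) using 1
      rw [Real.norm_eq_abs, secondDiff, show x + 2 * (s + t) = x + 2 * s + 2 * t by ring,
        ← add_assoc]
      congr 1
      ring
  have := (convex_Icc 0 a).norm_image_sub_le_of_norm_hasDerivWithin_le
    (f := fun s => s * (a * f x) - 2 * (G (x + a + s) - G (x + s)) +
      (G (x + 2 * a + 2 * s) - G (x + 2 * s)) / 4) (C := C * a)
    (fun s _ => ((((hasDerivAt_id s).mul_const (a * f x)).sub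
      ((((hG _).comp_const_add (x + a) s).sub ((hG _).comp_const_add x s)).const_mul 2)).add
      (((hshift hG (x + 2 * a) s).sub (hshift hG x s)).div_const 4)).hasDerivWithinAt)
    (fun s hs => ?_) (left_mem_Icc.2 ha) (right_mem_Icc.2 ha)
  · rw [Real.norm_eq_abs, Real.norm_eq_abs, sub_zero, abs_of_nonneg ha, mul_assoc, ← sq] at this
    convert this using 2
    simp only [mul_zero, add_zero, secondDiff, show x + a + a = x + 2 * a by ring,
      show x + 2 * a + 2 * a = x + 2 * (2 * a) by ring]
    ring
  · convert h1 s hs using 1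
    rw [Real.norm_eq_abs, add_right_comm x a s, add_right_comm x (2 * a) (2 * s)]
    congr 1
    ring

/-- Approximation by a second order Steklov mean. -/
lemma exists_steklov {f V : ℝ → ℝ} (hf : Continuous f) {h C : ℝ} (hh : 0 < h)
    (hC : ∀ s x, 0 ≤ s → s ≤ h → 0 ≤ x → |secondDiff s f x| ≤ C * V x) :
    ∃ g g' g'' : ℝ → ℝ, (∀ x, HasDerivAt g (g' x) x) ∧ (∀ x, HasDerivAt g' (g'' x) x) ∧
      (∀ x, 0 ≤ x → |f x - g x| ≤ C * V x) ∧
      ∀ x, 0 ≤ x → |g'' x| ≤ 9 * C / h ^ 2 * V x := by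
  set F : ℝ → ℝ := fun x => ∫ u in (0 : ℝ)..x, f u
  have hF : ∀ x, HasDerivAt F (f x) x := fun x => hf.integral_hasStrictDerivAt 0 x |>.hasDerivAt
  have hFc : Continuous F := continuous_iff_continuousAt.2 fun x => (hF x).continuousAt
  set G : ℝ → ℝ := fun x => ∫ u in (0 : ℝ)..x, F u
  have hG : ∀ x, HasDerivAt G (F x) x := fun x => hFc.integral_hasStrictDerivAt 0 x |>.hasDerivAt
  -- The mean with `a = h / 2`, normalized by `a² = h² / 4`. It commutes with differentiation, so `S
  -- G` has second derivative `S f`, and `(2 + 1/4) * 4 = 9` gives the constant.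
  set S : (ℝ → ℝ) → ℝ → ℝ :=
    fun P x => (2 * secondDiff (h / 2) P x - secondDiff h P x / 4) * (4 / h ^ 2)
  have hS : ∀ {P P' : ℝ → ℝ}, (∀ x, HasDerivAt P (P' x) x) →
      ∀ x, HasDerivAt (S P) (S P' x) x := fun hP x =>
    (((hasDerivAt_secondDiff hP _ x).const_mul 2).sub
      ((hasDerivAt_secondDiff hP _ x).div_const 4)).mul_const _
  refine ⟨S G, S F, S f, hS hG, hS hF, fun x hx => ?_, fun x hx => ?_⟩
  · have := abs_sub_steklov_le hG hF (a := h / 2) (x := x) (C := C * V x) (by positivity)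
      fun s hs hs' => hC s x hs (by linarith) hx
    rw [show 2 * (h / 2) = h by ring] at this
    have e : f x - S G x = ((h / 2) ^ 2 * f x - 2 * secondDiff (h / 2) G x +
        secondDiff h G x / 4) * (4 / h ^ 2) := by
      simp only [S]; field_simp; ring
    rw [e, abs_mul, abs_of_pos (by positivity : 0 < 4 / h ^ 2)]
    calc _ ≤ C * V x * (h / 2) ^ 2 * (4 / h ^ 2) := by gcongr
      _ = _ := by field_simp; ring
  · have h1 := hC (h / 2) x (by positivity) (by linarith) hx
    have h2 := hC h x hh.le le_rfl hx
    simp only [S]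
    rw [abs_mul, abs_of_pos (by positivity : 0 < 4 / h ^ 2)]
    have h3 : |2 * secondDiff (h / 2) f x - secondDiff h f x / 4| ≤ 9 / 4 * (C * V x) := by
      rw [abs_le] at *
      constructor <;> linarith
    calc _ ≤ 9 / 4 * (C * V x) * (4 / h ^ 2) := by gcongr
      _ = _ := by field_simp

/-- Here `c` is the derivative at `y` of the Steklov mean. The sum of the weights at `t` and `y`
dominates `1 + u ^ p` between them, by monotonicity. -/
lemma exists_abs_sub_sub_le {p : ℕ} {f : ℝ → ℝ} (hf : Continuous f) {h C : ℝ} (hh : 0 < h)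
    (hC0 : 0 ≤ C)
    (hC : ∀ s x, 0 ≤ s → s ≤ h → 0 ≤ x → |secondDiff s f x| ≤ C * (1 + x ^ p)) {y : ℝ}
    (hy : 0 ≤ y) :
    ∃ c : ℝ, ∀ t, 0 ≤ t → |f t - f y - c * (t - y)| ≤
      C * ((1 + t ^ p) + (1 + y ^ p)) +
        9 * C / h ^ 2 * ((1 + t ^ p) + (1 + y ^ p)) * (t - y) ^ 2 := by
  obtain ⟨g, g', g'', hg, hg', hfg, hg''⟩ := exists_steklov (V := fun x => 1 + x ^ p) hf hh hC
  refine ⟨g' y, fun t ht => ?_⟩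
  have h1 := abs_sub_sub_mul_le hg hg' (y := y) (t := t)
    (B := 9 * C / h ^ 2 * ((1 + t ^ p) + (1 + y ^ p))) ?_
  · have h2 := hfg t ht
    have h3 := hfg y hy
    rw [abs_le] at *
    constructor <;> linarith
  · intro u hu
    have hu0 : 0 ≤ u := (le_min hy ht).trans hu.1
    refine (hg'' u hu0).trans (mul_le_mul_of_nonneg_left ?_ (by positivity))
    have hyp : 0 ≤ y ^ p := by positivity
    have htp : 0 ≤ t ^ p := by positivity
    rcases le_max_iff.1 hu.2 with hle | hle
    · linarith [pow_le_pow_left₀ hu0 hle p]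
    · linarith [pow_le_pow_left₀ hu0 hle p]

/-! ### Comparison with the value at the first moment. -/

/-- A bound for `n` times the coefficient of the weighted second central moment. -/
noncomputable def centralBound (p k : ℕ) : ℝ :=
  (2 * p + 1) ^ p * ((2 * p + k + 4) ^ 2 + 2) * (p + 2)

lemma centralBound_nonneg (p k : ℕ) : 0 ≤ centralBound p k := by
  unfold centralBound; positivity

/-- The constant in the estimate of `M_{n,k}(f; x) - f(y)`, where `y` is the first moment. -/
noncomputable def approxConst (p k : ℕ) : ℝ :=
  (2 * p + 1) ^ p + 1 + 9 * (4 * centralBound 0 k + 2 * centralBound p k +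
    2 * k ^ 2 * (1 + (2 * p + 1) ^ p))

lemma approxConst_pos (p k : ℕ) : 0 < approxConst p k := by
  have := centralBound_nonneg 0 k
  have := centralBound_nonneg p k
  unfold approxConst; positivity

lemma hasMean_of_abs_le {n k p : ℕ} {x B : ℝ} (hk : k ≤ n) (hp : p ≤ n) (hx : 0 < x)
    {f : ℝ → ℝ} (hf : ContinuousOn f (Ici 0)) (hB : ∀ t, 0 ≤ t → |f t| ≤ B * (1 + t ^ p)) :
    HasMean n k x f (M n k f x) ∧ |M n k f x| ≤ B * (1 + momentCoeff n k p * x ^ p) := by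
  have hV := ((hasMean_const hx hk 1).add (hasMean_pow hx hk hp)).const_mul B
  have hfm := hV.of_abs_le hx (hf.mono Ioi_subset_Ici_self) hB
  exact ⟨hfm, hfm.abs_le hx.le hV hB⟩

lemma hasMean_sub_firstMoment {n k : ℕ} {x : ℝ} (hk : k ≤ n) (hn : 1 ≤ n) (hx : 0 < x) :
    HasMean n k x (fun t => t - ((n : ℝ) - k + 1) / n * x) 0 := by
  refine ((hasMean_pow hx hk (m := 1) hn).add
    (hasMean_const hx hk (-(((n : ℝ) - k + 1) / n * x)))).congr (fun t => by ring) ?_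
  rw [momentCoeff_succ (m := 0) hk (by omega)]
  simp

lemma abs_M_sub_le {n k p : ℕ} (hk1 : 1 ≤ k) (hk : k ≤ n) (hp : p + 2 ≤ n) {f : ℝ → ℝ}
    (hf : Continuous f) {B : ℝ} (hB : ∀ t, 0 ≤ t → |f t| ≤ B * (1 + t ^ p)) {x C : ℝ}
    (hx : 0 < x) (hC0 : 0 ≤ C)
    (hC : ∀ s z, 0 ≤ s → s ≤ x / √n → 0 ≤ z → |secondDiff s f z| ≤ C * (1 + z ^ p)) :
    |M n k f x - f (((n : ℝ) - k + 1) / n * x)| ≤ approxConst p k * C * (1 + x ^ p) := by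
  have hn : (0 : ℝ) < n := by exact_mod_cast (by omega : 0 < n)
  have hn1 : (1 : ℝ) ≤ n := by exact_mod_cast (by omega : 1 ≤ n)
  have hk1' : (1 : ℝ) ≤ k := by exact_mod_cast hk1
  have hk' : (k : ℝ) ≤ n := by exact_mod_cast hk
  set y : ℝ := ((n : ℝ) - k + 1) / n * x with hy
  have hy0 : 0 ≤ y := mul_nonneg (div_nonneg (by linarith) hn.le) hx.le
  have hyx : y ≤ x := by
    refine mul_le_of_le_one_left hx.le ((div_le_one hn).2 (by linarith))
  have hd : (y - x) ^ 2 ≤ k ^ 2 * x ^ 2 / n := by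
    have e : (y - x) ^ 2 = (k - 1) ^ 2 * x ^ 2 / n ^ 2 := by
      rw [hy]; field_simp; ring
    rw [e]
    gcongr ?_ * _ / ?_
    · nlinarith
    · nlinarith
  obtain ⟨c, hc⟩ := exists_abs_sub_sub_le hf (div_pos hx (Real.sqrt_pos.2 hn)) hC0 hC hy0
  have hh2 : (x / √n) ^ 2 = x ^ 2 / n := by rw [div_pow, Real.sq_sqrt hn.le]
  rw [hh2] at hc
  set K : ℝ := 9 * C / (x ^ 2 / n) with hK
  have hK0 : 0 ≤ K := by positivity
  have hfm := (hasMean_of_abs_le hk (by omega) hx hf.continuousOn hB).1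
  -- The linear term drops out because `y` is the first moment.
  have hu : HasMean n k x (fun t => f t - f y - c * (t - y)) (M n k f x - f y) :=
    ((hfm.add (hasMean_const hx hk (-f y))).add
      ((hasMean_sub_firstMoment hk (by omega) hx).const_mul (-c))).congr
      (fun t => by rw [hy]; ring) (by ring)
  have hV := (hasMean_const hx hk (1 + (1 + x ^ p))).add (hasMean_pow hx hk (m := p) (by omega))
  have hq0 := hasMean_sub_sq_mul_pow (m := 0) hx hk (by omega)
  have hqp := hasMean_sub_sq_mul_pow (m := p) hx hk hp
  -- Mean of the majorant, with `(t - y)²` replaced by `2 (t - x)² + 2 (y - x)²` so that only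
  -- moments about `x` occur.
  have hv := (hV.const_mul C).add (((hq0.const_mul (2 * (2 + x ^ p))).add
    ((hqp.const_mul 2).add (hV.const_mul (2 * (y - x) ^ 2)))).const_mul K)
  have hD0 := centralMoment_le (p := 0) hk1 hk (by omega)
  have hDp := centralMoment_le hk1 hk hp
  have hA := momentCoeff_le hk1 hk (p := p) (by omega) p le_rfl
  have hA0 := momentCoeff_nonneg n k p
  rw [← centralBound] at hD0 hDp
  refine (hu.abs_le hx.le hv fun t ht => (hc t ht).trans ?_).trans ?_
  · have hyp : y ^ p ≤ x ^ p := pow_le_pow_left₀ hy0 hyx p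
    have htp : 0 ≤ t ^ p := by positivity
    have hxp : 0 ≤ x ^ p := by positivity
    have hsq : (t - y) ^ 2 ≤ 2 * (t - x) ^ 2 + 2 * (y - x) ^ 2 := by
      nlinarith [sq_nonneg ((t - x) + (y - x))]
    calc _ ≤ C * ((1 + t ^ p) + (1 + x ^ p)) + K * ((1 + t ^ p) + (1 + x ^ p)) *
          (2 * (t - x) ^ 2 + 2 * (y - x) ^ 2) := by gcongr
      _ = _ := by ring
  · have hxp : 0 ≤ x ^ p := by positivity
    set A := momentCoeff n k p
    set A' : ℝ := (2 * p + 1) ^ p with hA'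
    have hA1 : 1 ≤ A' := one_le_pow₀ (by linarith [p.cast_nonneg (α := ℝ)])
    have hE0 := centralBound_nonneg 0 k
    have hVb : 1 + (1 + x ^ p) + A * x ^ p ≤ (1 + A') * (1 + x ^ p) := by nlinarith
    have h2 : 2 + x ^ p ≤ 2 * (1 + x ^ p) := by linarith
    have hEp := centralBound_nonneg p k
    have hxp1 : x ^ (p + 2) ≤ (1 + x ^ p) * x ^ 2 := by
      rw [pow_add]; nlinarith [sq_nonneg x]
    -- Nonnegativity of the second central moment, needed to enlarge the factor multiplying it
    -- below.
    have hq0nn := (hasMean_const hx hk 0).abs_le hx.le hq0 fun t ht => by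
      rw [abs_zero]; positivity
    rw [abs_zero] at hq0nn
    calc _ ≤ C * ((1 + A') * (1 + x ^ p)) +
          K * (2 * (2 * (1 + x ^ p)) * (centralBound 0 k / n * x ^ (0 + 2)) +
            (2 * (centralBound p k / n * ((1 + x ^ p) * x ^ 2)) +
              2 * (k ^ 2 * x ^ 2 / n) * ((1 + A') * (1 + x ^ p)))) := by
          gcongr
      _ = _ := by
          rw [hK, approxConst, ← hA']
          field_simp
          ring

/-! ### Weights and moduli of continuity. -/

lemma weight_pos (p : ℕ) {x : ℝ} (hx : 0 ≤ x) : 0 < weight p x := by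
  unfold weight; split_ifs <;> positivity

/-- The product is 1 for `p ≥ 1` but 2 for `p = 0`; the bound 2 allows `1 + x ^ p` to serve for
every `p`. -/
lemma weight_mul_le (p : ℕ) {x : ℝ} (hx : 0 ≤ x) : weight p x * (1 + x ^ p) ≤ 2 := by
  unfold weight
  split_ifs with h
  · subst h; norm_num
  · have : 1 + x ^ p ≠ 0 := by positivity
    rw [one_div_mul_cancel this]; norm_num

lemma one_le_weight_mul (p : ℕ) {x : ℝ} (hx : 0 ≤ x) : 1 ≤ weight p x * (1 + x ^ p) := by
  unfold weight
  split_ifs with h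
  · subst h; norm_num
  · have : 1 + x ^ p ≠ 0 := by positivity
    rw [one_div_mul_cancel this]

lemma le_mul_of_weight_mul_le {p : ℕ} {x a b : ℝ} (hx : 0 ≤ x) (ha : 0 ≤ a)
    (h : weight p x * a ≤ b) : a ≤ b * (1 + x ^ p) :=
  calc a ≤ a * (weight p x * (1 + x ^ p)) := le_mul_of_one_le_right ha (one_le_weight_mul p hx)
    _ = weight p x * a * (1 + x ^ p) := by ring
    _ ≤ _ := by gcongr

lemma weight_mul_le_of_le_mul {p : ℕ} {x a b : ℝ} (hx : 0 ≤ x) (hb : 0 ≤ b)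
    (h : a ≤ b * (1 + x ^ p)) : weight p x * a ≤ 2 * b :=
  calc weight p x * a ≤ weight p x * (b * (1 + x ^ p)) :=
        mul_le_mul_of_nonneg_left h (weight_pos p hx).le
    _ = weight p x * (1 + x ^ p) * b := by ring
    _ ≤ _ := by gcongr; exact weight_mul_le p hx

lemma Cp.exists_abs_le {p : ℕ} {f : ℝ → ℝ} (hf : f ∈ Cp p) :
    ∃ B, 0 ≤ B ∧ ∀ t, 0 ≤ t → |f t| ≤ B * (1 + t ^ p) := by
  obtain ⟨B, hB⟩ := hf.1
  refine ⟨B, (abs_nonneg _).trans (hB 0 le_rfl), fun t ht => ?_⟩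
  refine le_mul_of_weight_mul_le ht (abs_nonneg _) ?_
  simpa [abs_mul, abs_of_pos (weight_pos p ht)] using hB t ht

lemma Cp.continuousOn {p : ℕ} {f : ℝ → ℝ} (hf : f ∈ Cp p) : ContinuousOn f (Ici 0) := by
  have hw : ContinuousOn (weight p) (Ici 0) := by
    unfold weight
    split_ifs
    · exact continuousOn_const
    · refine ContinuousOn.div (by fun_prop) (by fun_prop) fun t (ht : 0 ≤ t) => by positivity
  refine (hf.2.continuousOn.div hw fun t ht => (weight_pos p ht).ne').congr fun t ht => ?_
  have := (weight_pos p ht).ne'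
  simp only [Pi.div_apply]
  field_simp

/-- `x + d` is at most `1 + d` if `x ≤ 1`, and at most `(1 + d) * x` otherwise. -/
lemma one_add_pow_le {p : ℕ} {x t d : ℝ} (hx : 0 ≤ x) (ht : 0 ≤ t) (hd : 0 ≤ d)
    (h : t ≤ x + d) : 1 + t ^ p ≤ (1 + (1 + d) ^ p) * (1 + x ^ p) := by
  have h1 : t ^ p ≤ (1 + d) ^ p * (1 + x ^ p) := by
    rcases le_total x 1 with hx1 | hx1
    · calc t ^ p ≤ (1 + d) ^ p := by gcongr; linarith
        _ ≤ _ := le_mul_of_one_le_right (by positivity) (by linarith [pow_nonneg hx p])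
    · calc t ^ p ≤ ((1 + d) * x) ^ p := by gcongr; nlinarith
        _ ≤ _ := by rw [mul_pow]; gcongr; linarith
  nlinarith [pow_nonneg hx p]

/-- Guarantees that the suprema in `omega2` are over bounded sets, so that `sSup` does not take its
default value 0. -/
lemma exists_weight_mul_secondDiff_le {p : ℕ} {f : ℝ → ℝ} (hf : f ∈ Cp p) (δ : ℝ) :
    ∃ L, 0 ≤ L ∧ ∀ s ∈ Ioc 0 δ, ∀ x, 0 ≤ x → weight p x * |secondDiff s f x| ≤ L := by
  obtain ⟨B, hB0, hB⟩ := Cp.exists_abs_le hf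
  rcases le_or_gt δ 0 with hδ | hδ
  · exact ⟨0, le_rfl, fun s hs => absurd (hs.1.trans_le hs.2) hδ.not_gt⟩
  set L := B * (1 + (1 + 2 * δ) ^ p)
  refine ⟨2 * (4 * L), by positivity, fun s hs x hx => ?_⟩
  refine weight_mul_le_of_le_mul hx (by positivity) ?_
  have hs0 := hs.1
  have hsδ := hs.2
  have key : ∀ t, 0 ≤ t → t ≤ x + 2 * δ → |f t| ≤ L * (1 + x ^ p) := fun t ht h =>
    (hB t ht).trans <| by
      rw [mul_assoc]; exact mul_le_mul_of_nonneg_left (one_add_pow_le hx ht (by positivity) h) hB0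
  have h1 := key (x + 2 * s) (by positivity) (by linarith)
  have h2 := key (x + s) (by positivity) (by linarith)
  have h3 := key x hx (by linarith)
  rw [secondDiff]
  rw [abs_le] at *
  constructor <;> linarith

lemma omega2_nonneg (p : ℕ) (f : ℝ → ℝ) (δ : ℝ) : 0 ≤ omega2 p f δ := by
  refine Real.sSup_nonneg ?_
  rintro _ ⟨s, -, rfl⟩
  refine Real.sSup_nonneg ?_
  rintro _ ⟨x, hx, rfl⟩
  exact mul_nonneg (weight_pos p hx).le (abs_nonneg _)

lemma abs_secondDiff_le {p : ℕ} {f : ℝ → ℝ} (hf : f ∈ Cp p) {δ s x : ℝ} (hs : 0 ≤ s)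
    (hsδ : s ≤ δ) (hx : 0 ≤ x) :
    |secondDiff s f x| ≤ omega2 p f δ * (1 + x ^ p) := by
  -- Step 0 lies outside the supremum but is needed for the Steklov mean; its second difference
  -- vanishes.
  rcases hs.eq_or_lt with rfl | hs
  · have e : secondDiff 0 f x = 0 := by simp only [secondDiff, mul_zero, add_zero]; ring
    rw [e, abs_zero]
    exact mul_nonneg (omega2_nonneg p f δ) (by positivity)
  obtain ⟨L, hL0, hL⟩ := exists_weight_mul_secondDiff_le hf δ
  refine le_mul_of_weight_mul_le hx (abs_nonneg _) ?_
  have h1 : weight p x * |secondDiff s f x| ≤ wnorm p (secondDiff s f) := by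
    refine le_csSup ⟨L, ?_⟩ ⟨x, hx, rfl⟩
    rintro _ ⟨z, hz, rfl⟩
    exact hL s ⟨hs, hsδ⟩ z hz
  refine h1.trans (le_csSup ⟨L, ?_⟩ ⟨s, ⟨hs, hsδ⟩, rfl⟩)
  rintro _ ⟨r, hr, rfl⟩
  refine Real.sSup_le ?_ hL0
  rintro _ ⟨z, hz, rfl⟩
  exact hL r hr z hz

lemma weight_mul_abs_sub_le_omega1 {p : ℕ} {f : ℝ → ℝ} (hf : f ∈ Cp p)
    {δ t x : ℝ} (ht : 0 ≤ t) (hx : 0 ≤ x) (h : |t - x| ≤ δ) :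
    weight p x * |f t - f x| ≤ omega1 p f δ := by
  obtain ⟨B, hB0, hB⟩ := Cp.exists_abs_le hf
  have hδ : 0 ≤ δ := (abs_nonneg _).trans h
  refine le_csSup ⟨2 * (2 * (B * (1 + (1 + δ) ^ p))), ?_⟩ ⟨t, x, ht, hx, h, rfl⟩
  rintro _ ⟨t, x, ht, hx, h, rfl⟩
  refine weight_mul_le_of_le_mul hx (by positivity) ?_
  have key : ∀ t, 0 ≤ t → t ≤ x + δ → |f t| ≤ B * (1 + (1 + δ) ^ p) * (1 + x ^ p) := fun t ht h =>
    (hB t ht).trans <| by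
      rw [mul_assoc]; exact mul_le_mul_of_nonneg_left (one_add_pow_le hx ht hδ h) hB0
  have h1 := key t ht (by linarith [le_abs_self (t - x)])
  have h2 := key x hx (by linarith)
  rw [abs_le] at *
  constructor <;> linarith

/-! ### The two estimates. -/

lemma weight_mul_abs_M_sub_le {p : ℕ} {f : ℝ → ℝ} (hf : f ∈ Cp p)
    {n k : ℕ} (hk1 : 1 ≤ k) (hk : k ≤ n) (hp : p + 2 ≤ n) {x : ℝ}
    (hx : 0 < x) :
    weight p x * |M n k f x - f x| ≤ 2 * approxConst p k * omega2 p f (x / √n) +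
      omega1 p f (|1 - (k : ℝ)| / n * x) := by
  obtain ⟨B, hB0, hB⟩ := Cp.exists_abs_le hf
  have hn : (0 : ℝ) < n := by exact_mod_cast (by omega : 0 < n)
  have hk' : (k : ℝ) ≤ n := by exact_mod_cast hk
  -- A continuous extension of `f` from `[0, ∞)` to the line, so that antiderivatives exist
  -- everywhere; all quantities involved see only `[0, ∞)`.
  set φ : ℝ → ℝ := fun t => f (max t 0)
  have hφ : Continuous φ := (Cp.continuousOn hf).comp_continuous (by fun_prop)
    fun t => le_max_right t 0
  have hφf : ∀ t, 0 ≤ t → φ t = f t := fun t ht => by simp only [φ, max_eq_left ht]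
  have hM : M n k φ x = M n k f x :=
    setIntegral_congr_fun measurableSet_Ioi fun t (ht : 0 < t) => by simp only [hφf t ht.le]
  set y : ℝ := ((n : ℝ) - k + 1) / n * x with hy
  have hy0 : 0 ≤ y := mul_nonneg (div_nonneg (by linarith) hn.le) hx.le
  have h1 := abs_M_sub_le hk1 hk hp hφ (B := B) (fun t ht => by rw [hφf t ht]; exact hB t ht) hx
    (omega2_nonneg p f (x / √n)) fun s z hs hs' hz => by
      have := abs_secondDiff_le hf hs hs' hz
      rw [secondDiff] at this ⊢
      rwa [hφf _ (by positivity), hφf _ (by positivity), hφf z hz]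
  rw [hM, ← hy, hφf y hy0] at h1
  have h2 := weight_mul_le_of_le_mul hx.le
    (mul_nonneg (approxConst_pos p k).le (omega2_nonneg p f _)) h1
  have h3 := weight_mul_abs_sub_le_omega1 hf hy0 hx.le (δ := |1 - (k : ℝ)| / n * x) <| by
    have e : y - x = (1 - k) / n * x := by rw [hy]; field_simp; ring
    rw [e, abs_mul, abs_div, abs_of_pos hn, abs_of_pos hx]
  calc _ ≤ weight p x * (|M n k f x - f y| + |f y - f x|) :=
        mul_le_mul_of_nonneg_left (abs_sub_le _ _ _) (weight_pos p hx.le).le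
    _ ≤ _ := by rw [mul_add, mul_assoc 2]; exact add_le_add h2 h3

/-- Covers the range where `x / √n` is not small, on which the Lipschitz condition gives no
information. -/
lemma exists_weight_mul_abs_M_sub_le_const {p : ℕ} {f : ℝ → ℝ} (hf : f ∈ Cp p)
    {k : ℕ} (hk1 : 1 ≤ k) :
    ∃ L, 0 ≤ L ∧ ∀ n : ℕ, k ≤ n → p + 2 ≤ n → ∀ x, 0 < x →
      weight p x * |M n k f x - f x| ≤ L := by
  obtain ⟨B, hB0, hB⟩ := Cp.exists_abs_le hf
  set A' : ℝ := (2 * p + 1) ^ p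
  refine ⟨2 * (B * (A' + 1)), by positivity, fun n hk hp x hx => ?_⟩
  refine weight_mul_le_of_le_mul hx.le (by positivity) ?_
  have h1 := (hasMean_of_abs_le hk (by omega) hx (Cp.continuousOn hf) hB).2
  have hA := momentCoeff_le hk1 hk (p := p) (by omega) p le_rfl
  have hA1 : 1 ≤ A' := one_le_pow₀ (by linarith [p.cast_nonneg (α := ℝ)])
  have h2 : 1 + momentCoeff n k p * x ^ p ≤ A' * (1 + x ^ p) := by
    nlinarith [pow_nonneg hx.le p]
  calc |M n k f x - f x| ≤ |M n k f x| + |f x| := abs_sub _ _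
    _ ≤ B * (A' * (1 + x ^ p)) + B * (1 + x ^ p) :=
        add_le_add (h1.trans (mul_le_mul_of_nonneg_left h2 hB0)) (hB x hx.le)
    _ = _ := by ring

lemma omega1_nonneg (p : ℕ) (f : ℝ → ℝ) (δ : ℝ) : 0 ≤ omega1 p f δ := by
  refine Real.sSup_nonneg ?_
  rintro _ ⟨t, x, -, hx, -, rfl⟩
  exact mul_nonneg (weight_pos p hx).le (abs_nonneg _)

end GammaType

theorem theoremt4 (p k : ℕ) (hk : 1 ≤ k) :
    (∃ N : ℝ, 0 < N ∧ ∀ n : ℕ, k ≤ n → p + 2 ≤ n →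
      ∀ f ∈ GammaType.Cp p, ∀ x : ℝ, 0 < x →
        GammaType.weight p x * |GammaType.M n k f x - f x| ≤
          N * GammaType.omega2 p f (x / Real.sqrt n) +
            GammaType.omega1 p f (|1 - (k : ℝ)| / n * x)) ∧
    (∀ α : ℝ, 0 < α → α ≤ 2 → ∀ f ∈ GammaType.Lip2 p α,
      ∃ C : ℝ, 0 < C ∧ ∀ n : ℕ, k ≤ n → p + 2 ≤ n → ∀ x : ℝ, 0 < x →
        GammaType.weight p x * |GammaType.M n k f x - f x| ≤
          C * (x ^ 2 / n) ^ (α / 2) +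
            GammaType.omega1 p f (|1 - (k : ℝ)| / n * x)) := by
  have hN := GammaType.approxConst_pos p k
  refine ⟨⟨2 * GammaType.approxConst p k, by positivity, fun n hkn hp f hf x hx =>
    GammaType.weight_mul_abs_M_sub_le hf hk hkn hp hx⟩, fun α hα _ f hf => ?_⟩
  obtain ⟨hf, hO⟩ := hf
  obtain ⟨c, hc, hO⟩ := hO.exists_pos
  obtain ⟨δ, hδ, hδO⟩ := (mem_nhdsGT_iff_exists_Ioo_subset).1 hO.bound
  have hδ : 0 < δ := hδ
  obtain ⟨L, hL0, hL⟩ := GammaType.exists_weight_mul_abs_M_sub_le_const hf hk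
  have hLδ : 0 ≤ L / δ ^ α := by positivity
  -- The first summand serves `x / √n < δ`, the second `x / √n ≥ δ`, where `(x / √n) ^ α ≥ δ ^ α`.
  refine ⟨2 * GammaType.approxConst p k * c + L / δ ^ α, by positivity,
    fun n hkn hp x hx => ?_⟩
  have hn : (0 : ℝ) < n := by exact_mod_cast (by omega : 0 < n)
  have hxn : 0 < x / √n := by positivity
  have e : (x ^ 2 / n : ℝ) ^ (α / 2) = (x / √n) ^ α := by
    rw [show (x ^ 2 / n : ℝ) = (x / √n) ^ (2 : ℝ) by
      rw [Real.rpow_two, div_pow, Real.sq_sqrt hn.le], ← Real.rpow_mul hxn.le]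
    congr 1; ring
  have hpos : 0 < (x / √n) ^ α := by positivity
  rw [e, add_mul]
  rcases lt_or_ge (x / √n) δ with hlt | hge
  · have h1 := GammaType.weight_mul_abs_M_sub_le hf hk hkn hp hx
    have h2 : GammaType.omega2 p f (x / √n) ≤ c * (x / √n) ^ α := by
      have : ‖GammaType.omega2 p f (x / √n)‖ ≤ c * ‖(x / √n) ^ α‖ := hδO ⟨hxn, hlt⟩
      rw [Real.norm_of_nonneg hpos.le] at this
      exact (le_abs_self _).trans this
    have h3 := mul_le_mul_of_nonneg_left h2 (by positivity : 0 ≤ 2 * GammaType.approxConst p k)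
    have h4 := mul_nonneg hLδ hpos.le
    linarith
  · have h1 := hL n hkn hp x hx
    have h2 : L ≤ L / δ ^ α * (x / √n) ^ α := by
      rw [div_mul_eq_mul_div, le_div_iff₀ (by positivity)]
      exact mul_le_mul_of_nonneg_left (Real.rpow_le_rpow hδ.le hge hα.le) hL0
    have h3 := GammaType.omega1_nonneg p f (|1 - (k : ℝ)| / n * x)
    have h4 : 0 ≤ 2 * GammaType.approxConst p k * c * (x / √n) ^ α := by positivity
    linarith
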